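/- Let $\gamma>1$, let either $\mu=1$ and $0\le\lambda\le2$, or $\mu>1$ and $\lambda\ge0$, and put $p(u)=u^{-\gamma}/\gamma$. Consider the Cauchy problem $$u_t-v_x=0,\qquad v_t+p(u)_x=-\frac{\lambda}{(1+t)^\mu}\,v,\qquad (u,v)(0,x)=(u_0(x),v_0(x)),\qquad t\ge0,\ x\in\mathbb R,$$ with Riemann invariants $r=v-\eta$, $s=v+\eta$, where $\eta=\int_u^\infty\sqrt{-p'(\xi)}\,d\xi=\frac{2}{\gamma-1}u^{-(\gamma-1)/2}$. For $m,\delta>0$ let $X_{m,\delta}$ be the set of pairs $(u,v)$ of bounded $C^1$ functions on $\mathbb R$ with bounded derivatives such that $\|u\|_{L^\infty}+\|v\|_{L^\infty}\le m$ and $u\ge\delta$. For a $C^1$ solution with $u>0$ put $$N(t)=\|(u,v)(t)\|_{L^\infty}+\|(u_t,v_t)(t)\|_{L^\infty}+\|(u_x,v_x)(t)\|_{L^\infty}+\|p'(u(t))\|_{L^\infty}.$$ The lifespan $T^*\in[0,\infty]$ of the data $(u_0,v_0)$ is the supremum of all $T>0$ for which there is a $C^1$ solution with $u>0$ on $[0,T)\times\mathbb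 R$ such that $\sup_{[0,T)}N<\infty$. Below, a solution on $[0,T)$, $T\le\infty$, is a $C^1$ solution with $u>0$ on $[0,T)\times\mathbb R$ such that $\sup_{[0,T')}N<\infty$ for every $T'<T$. For all $m,\delta>0$ there are constants $m_1,\delta_1,K>0$, depending only on $\gamma,\lambda,\mu,m,\delta$, such that the following holds for all $(u_0,v_0)\in X_{m,\delta}$ for which $$\lim_{x\to-\infty}(u_0(x),v_0(x))=(u_-,v_-)\ \text{ with } u_->0,\ v_-\in\mathbb R,\qquad \sup_{(x,y)\in\mathbb R^2}|s(0,x)+r(0,y)|<\frac{1}{\gamma-1}\,u_-^{-(\gamma-1)/2}.$$ (i) If $(u,v)$ is a solution on $[0,T)$ (in particular, if it is the solution on $[0,T^*)$), then $(u(t),v(t))\in X_{m_1,\delta_1}$ for all $t\in[0,T)$. In particular $u$, $v$ and $p'(u)$ stay uniformly bounded, and $u$ is bounded away from $0$. (ii) If in addition $r_x(0,x_0)\le-K$ or $s_x(0,x_0)\le-K$ for some $x_0\in\mathbb R$, then $T^*<\infty$. Moreover, if a solution $(u,v)$ on $[0,T)$ breaks down at $T$, that is, $\sup_{[0,T)}N=\infty$,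 then this is a derivative blow-up: $$\limsup_{t\nearrow T}\bigl(\|(u_t,v_t)(t)\|_{L^\infty}+\|(u_x,v_x)(t)\|_{L^\infty}\bigr)=\infty.$$ -/

import Mathlib

open Set Filter Topology

noncomputable section

namespace DampedPSystem

/-- The pressure `p(u) = u^{-γ} / γ`. -/
def pressure (γ u : ℝ) : ℝ := u ^ (-γ) / γ

/-- `η(u) = ∫_u^∞ √(-p'(ξ)) dξ = 2/(γ-1) · u^{-(γ-1)/2}`. -/
def eta (γ u : ℝ) : ℝ := 2 / (γ - 1) * u ^ (-(γ - 1) / 2)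

/-- The Riemann invariant `r = v - η(u)` of a pair of functions of `x`. -/
def riemannR (γ : ℝ) (u v : ℝ → ℝ) (x : ℝ) : ℝ := v x - eta γ (u x)

/-- The Riemann invariant `s = v + η(u)` of a pair of functions of `x`. -/
def riemannS (γ : ℝ) (u v : ℝ → ℝ) (x : ℝ) : ℝ := v x + eta γ (u x)

/-- The space `C¹_b(ℝ)`: continuously differentiable, bounded, with bounded derivative. -/
def IsC1b (f : ℝ → ℝ) : Prop :=
  ContDiff ℝ 1 f ∧ (∃ C : ℝ, ∀ x, |f x| ≤ C) ∧ ∃ C : ℝ, ∀ x, |deriv f x| ≤ C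

/-- The class `X_{m,δ}`: pairs in `C¹_b(ℝ) × C¹_b(ℝ)` with `‖u‖_∞ + ‖v‖_∞ ≤ m` and `u ≥ δ`.
The bound on the sum of the two suprema is written as `|u x| + |v y| ≤ m` for all `x`, `y`. -/
structure InX (m δ : ℝ) (u v : ℝ → ℝ) : Prop where
  u_c1b : IsC1b u
  v_c1b : IsC1b v
  norm_le : ∀ x y, |u x| + |v y| ≤ m
  le_u : ∀ x, δ ≤ u x

/-- The partial derivative in `t`; it is one-sided at `t = 0`. -/
def dt (f : ℝ → ℝ → ℝ) (t x : ℝ) : ℝ := derivWithin (fun τ => f τ x) (Ici 0) t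

/-- The partial derivative in `x`. -/
def dx (f : ℝ → ℝ → ℝ) (t x : ℝ) : ℝ := deriv (fun y => f t y) x

/-- The strip `[0,T) × ℝ`, for `T ∈ [0,∞]`. -/
def strip (T : ENNReal) : Set (ℝ × ℝ) := {q | 0 ≤ q.1 ∧ ENNReal.ofReal q.1 < T}

/-- `(u,v)` (as functions of `t`, then `x`) is a `C¹` solution on `[0,T) × ℝ`, with `u > 0`, of
`u_t - v_x = 0`, `v_t + p(u)_x = -λ/(1+t)^μ · v`, `(u,v)(0,·) = (u₀,v₀)`. -/
structure IsClassicalSolution (γ lam μ : ℝ) (u₀ v₀ : ℝ → ℝ) (T : ENNReal) (u v : ℝ → ℝ → ℝ) :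
    Prop where
  u_c1 : ContDiffOn ℝ 1 (fun q : ℝ × ℝ => u q.1 q.2) (strip T)
  v_c1 : ContDiffOn ℝ 1 (fun q : ℝ × ℝ => v q.1 q.2) (strip T)
  u_pos : ∀ t x, (t, x) ∈ strip T → 0 < u t x
  mass : ∀ t x, (t, x) ∈ strip T → dt u t x - dx v t x = 0
  momentum : ∀ t x, (t, x) ∈ strip T →
    dt v t x + dx (fun τ y => pressure γ (u τ y)) t x = -(lam / (1 + t) ^ μ) * v t x
  u_init : ∀ x, u 0 x = u₀ x
  v_init : ∀ x, v 0 x = v₀ x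

/-- The sup norms over `x` of `u, v, u_t, v_t, u_x, v_x` and `p'(u)` are bounded uniformly for
`t ∈ [0,T)`. -/
def NormsBounded (γ : ℝ) (T : ENNReal) (u v : ℝ → ℝ → ℝ) : Prop :=
  ∃ C : ℝ, ∀ t x, (t, x) ∈ strip T →
    |u t x| ≤ C ∧ |v t x| ≤ C ∧ |dt u t x| ≤ C ∧ |dt v t x| ≤ C ∧
      |dx u t x| ≤ C ∧ |dx v t x| ≤ C ∧ |deriv (pressure γ) (u t x)| ≤ C

/-- A solution on `[0,T)` in the class in which the Cauchy problem is posed: a `C¹` solution whose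
norms are bounded on `[0,T')` for each `T' < T`. -/
structure IsSolution (γ lam μ : ℝ) (u₀ v₀ : ℝ → ℝ) (T : ENNReal) (u v : ℝ → ℝ → ℝ) :
    Prop where
  classical : IsClassicalSolution γ lam μ u₀ v₀ T u v
  bounded : ∀ T' < T, NormsBounded γ T' u v

/-- The lifespan `T* ∈ [0,∞]` for the data `(u₀,v₀)`: the supremum of the `T > 0` such that there
is a `C¹` solution on `[0,T)` whose norms are bounded on the whole of `[0,T)`. -/
def lifespan (γ lam μ : ℝ) (u₀ v₀ : ℝ → ℝ) : ENNReal :=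
  sSup {T | 0 < T ∧ ∃ u v : ℝ → ℝ → ℝ,
    IsClassicalSolution γ lam μ u₀ v₀ T u v ∧ NormsBounded γ T u v}

/-- `limsup_{t ↗ T} (‖(u_t,v_t)(t)‖_∞ + ‖(u_x,v_x)(t)‖_∞) = ∞`. -/
def DerivativeBlowUp (T : ENNReal) (u v : ℝ → ℝ → ℝ) : Prop :=
  ∀ M : ℝ, ∀ T₀ < T, ∃ t x, (t, x) ∈ strip T ∧ T₀ ≤ ENNReal.ofReal t ∧
    M < |dt u t x| + |dt v t x| + |dx u t x| + |dx v t x|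

end DampedPSystem

end

/-!
The Riemann invariants `r` and `s` are transported along characteristics, up to the damping term
`-λ/(1+t)^μ v`. Measured relative to a reference state that depends only on `t`, the damping drives
each of them towards the negative of the other, so that the suprema of their absolute values cannot
grow; a reference state built from the data at one point far to the left gives the uniform bounds.
Along a characteristic, the slope of a Riemann invariant, weighted by `u^{-(γ+1)/4}` and corrected
by a function of `t` and `u`, solves a Riccati equation whose coefficients involve only `t` and `u`.
These are bounded, so a sufficiently negative initial slope becomes infinite before any prescribed
time. As solutions are only `C¹`, the equation for the slopes is obtained as the limit of the
integrated equations for difference quotients.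
-/

noncomputable section

namespace DampedPSystem

open Function (uncurry)

section Strip

variable {T : ENNReal} {f : ℝ → ℝ → ℝ} {X : ℝ → ℝ} {t t₁ x : ℝ}

lemma strip_eq (T : ENNReal) :
    strip T = (Ici (0 : ℝ) ×ˢ univ) ∩ Prod.fst ⁻¹' {t : ℝ | ENNReal.ofReal t < T} := by
  ext q; simp [strip]

lemma isOpen_setOf_ofReal_lt (T : ENNReal) : IsOpen {t : ℝ | ENNReal.ofReal t < T} :=
  isOpen_lt ENNReal.continuous_ofReal continuous_const

lemma uniqueDiffOn_strip (T : ENNReal) : UniqueDiffOn ℝ (strip T) := by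
  rw [strip_eq]
  exact ((uniqueDiffOn_Ici 0).prod uniqueDiffOn_univ).inter
    ((isOpen_setOf_ofReal_lt T).preimage continuous_fst)

lemma mem_strip_of_mem_Icc (hT : ENNReal.ofReal t₁ < T) (ht : t ∈ Icc 0 t₁) (x : ℝ) :
    (t, x) ∈ strip T :=
  ⟨ht.1, (ENNReal.ofReal_le_ofReal ht.2).trans_lt hT⟩

lemma contDiff_slice (hf : ContDiffOn ℝ 1 (uncurry f) (strip T)) (ht : (t, x) ∈ strip T) :
    ContDiff ℝ 1 (f t) := by
  rw [← contDiffOn_univ]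
  exact hf.comp (f := fun y => (t, y)) (by fun_prop) fun _ _ => ht

lemma hasDerivAt_dx (hf : ContDiffOn ℝ 1 (uncurry f) (strip T)) (hq : (t, x) ∈ strip T) :
    HasDerivAt (f t) (dx f t x) x :=
  ((contDiff_slice hf hq).differentiable one_ne_zero x).hasDerivAt

lemma hasDerivWithinAt_comp_path (hf : ContDiffOn ℝ 1 (uncurry f) (strip T)) {I : Set ℝ}
    {g : ℝ → ℝ} {s g' X' : ℝ} (hs : s ∈ I) (hI : ∀ τ ∈ I, (g τ, X τ) ∈ strip T)
    (hg : HasDerivWithinAt g g' I s) (hX : HasDerivWithinAt X X' I s) :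
    HasDerivWithinAt (fun τ => f (g τ) (X τ))
      (fderivWithin ℝ (uncurry f) (strip T) (g s, X s) (g', X')) I s :=
  (hf.differentiableOn one_ne_zero _ (hI s hs)).hasFDerivWithinAt.comp_hasDerivWithinAt_of_eq s
    (hg.prodMk hX) hI rfl

lemma dx_eq_fderivWithin (hf : ContDiffOn ℝ 1 (uncurry f) (strip T)) (hq : (t, x) ∈ strip T) :
    dx f t x = fderivWithin ℝ (uncurry f) (strip T) (t, x) (0, 1) :=
  (hasDerivAt_dx hf hq).unique
    (hasDerivWithinAt_univ.1 (hasDerivWithinAt_comp_path hf (g := fun _ => t) (X := id)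
      (mem_univ x) (fun _ _ => hq) (hasDerivWithinAt_const ..) (hasDerivWithinAt_id ..)))

lemma hasDerivWithinAt_fderivWithin_fst (hf : ContDiffOn ℝ 1 (uncurry f) (strip T))
    (hq : (t, x) ∈ strip T) :
    HasDerivWithinAt (fun τ => f τ x) (fderivWithin ℝ (uncurry f) (strip T) (t, x) (1, 0))
      (Ici 0) t :=
  (hasDerivWithinAt_comp_path hf (g := id) (X := fun _ => x)
    (I := Ici 0 ∩ {τ : ℝ | ENNReal.ofReal τ < T}) hq (fun _ hτ => hτ)
    (hasDerivWithinAt_id ..) (hasDerivWithinAt_const ..)).mono_of_mem_nhdsWithin <|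
    inter_mem self_mem_nhdsWithin
      (mem_nhdsWithin_of_mem_nhds ((isOpen_setOf_ofReal_lt T).mem_nhds hq.2))

lemma dt_eq_fderivWithin (hf : ContDiffOn ℝ 1 (uncurry f) (strip T)) (hq : (t, x) ∈ strip T) :
    dt f t x = fderivWithin ℝ (uncurry f) (strip T) (t, x) (1, 0) :=
  (hasDerivWithinAt_fderivWithin_fst hf hq).derivWithin (uniqueDiffOn_Ici 0 t hq.1)

lemma hasDerivWithinAt_dt (hf : ContDiffOn ℝ 1 (uncurry f) (strip T)) (hq : (t, x) ∈ strip T) :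
    HasDerivWithinAt (fun τ => f τ x) (dt f t x) (Ici 0) t :=
  (hasDerivWithinAt_fderivWithin_fst hf hq).differentiableWithinAt.hasDerivWithinAt

lemma hasDerivWithinAt_comp_curve (hf : ContDiffOn ℝ 1 (uncurry f) (strip T)) {I : Set ℝ} {X' : ℝ}
    (ht : t ∈ I) (hI : ∀ τ ∈ I, (τ, X τ) ∈ strip T) (hX : HasDerivWithinAt X X' I t) :
    HasDerivWithinAt (fun τ => f τ (X τ)) (dt f t (X t) + X' * dx f t (X t)) I t := by
  refine (hasDerivWithinAt_comp_path hf ht hI (hasDerivWithinAt_id t I) hX).congr_deriv ?_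
  have hsplit : ((1 : ℝ), X') = (1, 0) + X' • ((0 : ℝ), (1 : ℝ)) := by simp
  rw [hsplit, map_add, map_smul, dt_eq_fderivWithin hf (hI t ht), dx_eq_fderivWithin hf (hI t ht),
    smul_eq_mul]

lemma continuousOn_dx (hf : ContDiffOn ℝ 1 (uncurry f) (strip T)) :
    ContinuousOn (uncurry (dx f)) (strip T) :=
  ((hf.continuousOn_fderivWithin (uniqueDiffOn_strip T) le_rfl).clm_apply
    (continuousOn_const (c := ((0 : ℝ), (1 : ℝ))))).congr fun _ hq => dx_eq_fderivWithin hf hq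

end Strip

section IntegralCurves

variable {E : Type*} [NormedAddCommGroup E] [NormedSpace ℝ E] [CompleteSpace E] {a b : ℝ}

lemma exists_global_integralCurve {c : ℝ → E → E} {C L : NNReal}
    (hcont : ∀ x, ContinuousOn (fun t => c t x) (Icc a b)) (hC : ∀ t ∈ Icc a b, ∀ x, ‖c t x‖ ≤ C)
    (hL : ∀ t ∈ Icc a b, LipschitzWith L (c t)) {t₀ : ℝ} (ht₀ : t₀ ∈ Icc a b) (x₀ : E) :
    ∃ X : ℝ → E, X t₀ = x₀ ∧ ∀ t ∈ Icc a b, HasDerivWithinAt X (c t (X t)) (Icc a b) t := by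
  have hab : 0 ≤ b - a := sub_nonneg.2 (ht₀.1.trans ht₀.2)
  have hPL : IsPicardLindelof c (⟨t₀, ht₀⟩ : Icc a b) x₀ (C * (b - a).toNNReal) 0 C L :=
    { lipschitzOnWith t ht := (hL t ht).lipschitzOnWith
      continuousOn x _ := hcont x
      norm_le t ht x _ := hC t ht x
      mul_max_le := by
        rw [NNReal.coe_zero, sub_zero, NNReal.coe_mul, Real.coe_toNNReal _ hab]
        exact mul_le_mul_of_nonneg_left
          (max_le (sub_le_sub_left ht₀.1 b) (sub_le_sub_right ht₀.2 a)) C.2 }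
  exact hPL.exists_eq_forall_mem_Icc_hasDerivWithinAt₀

lemma exists_characteristic_of_abs_le {T : ENNReal} {c : ℝ → ℝ → ℝ} {t₀ t₁ C L : ℝ}
    (hc : ContDiffOn ℝ 1 (uncurry c) (strip T)) (hT : ENNReal.ofReal t₁ < T)
    (hC : ∀ t ∈ Icc 0 t₁, ∀ x, |c t x| ≤ C) (hL : ∀ t ∈ Icc 0 t₁, ∀ x, |dx c t x| ≤ L)
    (ht₀ : t₀ ∈ Icc 0 t₁) (x₀ : ℝ) :
    ∃ X : ℝ → ℝ, X t₀ = x₀ ∧ ∀ t ∈ Icc 0 t₁, HasDerivWithinAt X (c t (X t)) (Icc 0 t₁) t := by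
  refine exists_global_integralCurve (C := C.toNNReal) (L := L.toNNReal) (fun x => ?_)
    (fun t ht x => (hC t ht x).trans (Real.le_coe_toNNReal C)) (fun t ht => ?_) ht₀ x₀
  · exact hc.continuousOn.comp (f := fun t => (t, x)) (by fun_prop)
      fun _ ht => mem_strip_of_mem_Icc hT ht x
  · exact lipschitzWith_of_nnnorm_deriv_le
      ((contDiff_slice hc (mem_strip_of_mem_Icc hT ht 0)).differentiable one_ne_zero)
      fun x => NNReal.coe_le_coe.1 ((hL t ht x).trans (Real.le_coe_toNNReal L))

lemma hasDerivWithinAt_of_eq_add_integral {w W : ℝ → E} (hW : ContinuousOn W (Icc a b))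
    (hw : ∀ t ∈ Icc a b, w t = w a + ∫ τ in a..t, W τ) {t : ℝ} (ht : t ∈ Icc a b) :
    HasDerivWithinAt w (W t) (Icc a b) t := by
  have : Fact (t ∈ Icc a b) := ⟨ht⟩
  have hint : IntervalIntegrable W MeasureTheory.volume a t :=
    (hW.mono (Icc_subset_Icc_right ht.2)).intervalIntegrable_of_Icc ht.1
  exact ((intervalIntegral.integral_hasDerivWithinAt_right hint
    (hW.stronglyMeasurableAtFilter_nhdsWithin measurableSet_Icc t) (hW t ht)).const_add
      (w a)).congr hw (hw t ht)

lemma hasDerivWithinAt_of_tendsto {ι : Type*} {l : Filter ι} [l.NeBot] [l.IsCountablyGenerated]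
    {g G : ι → ℝ → E} {w W : ℝ → E} {C : ℝ}
    (hg : ∀ᶠ i in l, ∀ t ∈ Icc a b, HasDerivWithinAt (g i) (G i t) (Icc a b) t)
    (hG : ∀ᶠ i in l, ContinuousOn (G i) (Icc a b))
    (hGC : ∀ᶠ i in l, ∀ t ∈ Icc a b, ‖G i t‖ ≤ C)
    (hgw : ∀ t ∈ Icc a b, Tendsto (fun i => g i t) l (𝓝 (w t)))
    (hGW : ∀ t ∈ Icc a b, Tendsto (fun i => G i t) l (𝓝 (W t)))
    (hW : ContinuousOn W (Icc a b)) {t : ℝ} (ht : t ∈ Icc a b) :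
    HasDerivWithinAt w (W t) (Icc a b) t := by
  refine hasDerivWithinAt_of_eq_add_integral hW (fun t ht => ?_) ht
  have hsub : Icc a t ⊆ Icc a b := Icc_subset_Icc_right ht.2
  have hsub' : uIoc a t ⊆ Icc a b := by
    rw [uIoc_of_le ht.1]; exact Ioc_subset_Icc_self.trans hsub
  have hFTC : ∀ᶠ i in l, ∫ τ in a..t, G i τ = g i t - g i a := by
    filter_upwards [hg, hG] with i hgi hGi
    exact intervalIntegral.integral_eq_sub_of_hasDerivAt_of_le ht.1
      (fun τ hτ => (hgi τ (hsub hτ)).continuousWithinAt.mono hsub)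
      (fun τ hτ => (hgi τ (hsub (Ioo_subset_Icc_self hτ))).hasDerivAt
        (Icc_mem_nhds hτ.1 (hτ.2.trans_le ht.2)))
      ((hGi.mono hsub).intervalIntegrable_of_Icc ht.1)
  have hlim : Tendsto (fun i => ∫ τ in a..t, G i τ) l (𝓝 (∫ τ in a..t, W τ)) := by
    refine intervalIntegral.tendsto_integral_filter_of_dominated_convergence (fun _ => C) ?_ ?_
      intervalIntegrable_const (.of_forall fun τ hτ => hGW τ (hsub' hτ))
    · filter_upwards [hG] with i hGi
      exact (hGi.mono hsub').aestronglyMeasurable measurableSet_uIoc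
    · filter_upwards [hGC] with i hGi
      exact .of_forall fun τ hτ => hGi τ (hsub' hτ)
  have hlim' : Tendsto (fun i => g i t - g i a) l (𝓝 (w t - w a)) :=
    (hgw t ht).sub (hgw a (left_mem_Icc.2 (ht.1.trans ht.2)))
  rw [tendsto_nhds_unique (hlim.congr' hFTC) hlim', add_sub_cancel]

end IntegralCurves

section DifferenceQuotient

variable {T : ENNReal} {f c b : ℝ → ℝ → ℝ} {X : ℝ → ℝ} {t t₁ x : ℝ}

/-- The forward difference quotient in `x` with step `h`. It stands in for `f_x` in equations which
cannot be differentiated in `x`, the functions involved being only `C¹`. -/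
def diffQuot (f : ℝ → ℝ → ℝ) (h t x : ℝ) : ℝ := (f t (x + h) - f t x) / h

lemma tendsto_diffQuot (hf : ContDiffOn ℝ 1 (uncurry f) (strip T)) (hq : (t, x) ∈ strip T) :
    Tendsto (fun h => diffQuot f h t x) (𝓝[>] 0) (𝓝 (dx f t x)) := by
  have hslope := (hasDerivAt_iff_tendsto_slope_zero.1 (hasDerivAt_dx hf hq)).mono_left
    (nhdsWithin_mono 0 fun h (hh : 0 < h) => hh.ne')
  exact hslope.congr fun h => by rw [smul_eq_mul, diffQuot, div_eq_inv_mul]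

lemma continuousOn_along {F : ℝ → ℝ → ℝ} (hF : ContinuousOn (uncurry F) (strip T))
    (hT : ENNReal.ofReal t₁ < T) (hX : ContinuousOn X (Icc 0 t₁)) :
    ContinuousOn (fun t => F t (X t)) (Icc 0 t₁) :=
  hF.comp (f := fun t => (t, X t)) (continuousOn_id.prodMk hX)
    fun _ ht => mem_strip_of_mem_Icc hT ht _

lemma continuousOn_diffQuot_along (hf : ContDiffOn ℝ 1 (uncurry f) (strip T))
    (hT : ENNReal.ofReal t₁ < T) (hX : ContinuousOn X (Icc 0 t₁)) (h : ℝ) :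
    ContinuousOn (fun t => diffQuot f h t (X t)) (Icc 0 t₁) :=
  ((continuousOn_along hf.continuousOn hT (hX.add continuousOn_const)).sub
    (continuousOn_along hf.continuousOn hT hX)).div_const h

lemma exists_abs_le_near_curve {F : ℝ → ℝ → ℝ} (hF : ContinuousOn (uncurry F) (strip T))
    (hT : ENNReal.ofReal t₁ < T) (hX : ContinuousOn X (Icc 0 t₁)) :
    ∃ C, ∀ t ∈ Icc 0 t₁, ∀ h ∈ Icc (0 : ℝ) 1, |F t (X t + h)| ≤ C := by
  have hcont : ContinuousOn (fun q : ℝ × ℝ => F q.1 (X q.1 + q.2)) (Icc 0 t₁ ×ˢ Icc 0 1) :=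
    hF.comp (f := fun q : ℝ × ℝ => (q.1, X q.1 + q.2))
      (continuousOn_fst.prodMk ((hX.comp continuousOn_fst fun q hq => hq.1).add continuousOn_snd))
      fun q hq => mem_strip_of_mem_Icc hT hq.1 _
  obtain ⟨C, hC⟩ := (isCompact_Icc.prod isCompact_Icc).exists_bound_of_continuousOn hcont
  exact ⟨C, fun t ht h hh => hC (t, h) ⟨ht, hh⟩⟩

lemma exists_abs_diffQuot_le_near_curve (hf : ContDiffOn ℝ 1 (uncurry f) (strip T))
    (hT : ENNReal.ofReal t₁ < T) (hX : ContinuousOn X (Icc 0 t₁)) :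
    ∃ C, ∀ t ∈ Icc 0 t₁, ∀ h ∈ Ioc (0 : ℝ) 1, |diffQuot f h t (X t)| ≤ C := by
  obtain ⟨C, hC⟩ := exists_abs_le_near_curve (continuousOn_dx hf) hT hX
  refine ⟨C, fun t ht h hh => ?_⟩
  have hmvt : |f t (X t + h) - f t (X t)| ≤ C * |X t + h - X t| := by
    refine (convex_Icc (X t) (X t + h)).norm_image_sub_le_of_norm_hasDerivWithin_le
      (fun y _ => (hasDerivAt_dx hf (mem_strip_of_mem_Icc hT ht y)).hasDerivWithinAt)
      (fun y hy => ?_) (left_mem_Icc.2 (by linarith [hh.1])) (right_mem_Icc.2 (by linarith [hh.1]))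
    simpa using hC t ht (y - X t) ⟨by linarith [hy.1], by linarith [hy.2, hh.2]⟩
  rw [add_sub_cancel_left] at hmvt
  rwa [diffQuot, abs_div, div_le_iff₀ (abs_pos.2 hh.1.ne')]

lemma hasDerivWithinAt_diffQuot_of_transport (hf : ContDiffOn ℝ 1 (uncurry f) (strip T))
    (heq : ∀ t x, (t, x) ∈ strip T → dt f t x + c t x * dx f t x = b t x)
    (hT : ENNReal.ofReal t₁ < T)
    (hX : ∀ t ∈ Icc 0 t₁, HasDerivWithinAt X (c t (X t)) (Icc 0 t₁) t) (h : ℝ)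
    (ht : t ∈ Icc 0 t₁) :
    HasDerivWithinAt (fun t => diffQuot f h t (X t))
      (diffQuot b h t (X t) - diffQuot c h t (X t) * dx f t (X t + h)) (Icc 0 t₁) t := by
  have hin : ∀ y, ∀ τ ∈ Icc 0 t₁, (τ, X τ + y) ∈ strip T :=
    fun y τ hτ => mem_strip_of_mem_Icc hT hτ _
  have hshift := hasDerivWithinAt_comp_curve hf ht (hin h) ((hX t ht).add_const h)
  have hbase :=
    hasDerivWithinAt_comp_curve hf ht (fun τ hτ => mem_strip_of_mem_Icc hT hτ _) (hX t ht)
  refine ((hshift.sub hbase).div_const h).congr_deriv ?_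
  rw [heq t (X t) (mem_strip_of_mem_Icc hT ht _),
    eq_sub_of_add_eq (heq t (X t + h) (hin h t ht)), diffQuot, diffQuot]
  ring

theorem hasDerivWithinAt_dx_of_transport (hf : ContDiffOn ℝ 1 (uncurry f) (strip T))
    (hc : ContDiffOn ℝ 1 (uncurry c) (strip T)) (hb : ContDiffOn ℝ 1 (uncurry b) (strip T))
    (heq : ∀ t x, (t, x) ∈ strip T → dt f t x + c t x * dx f t x = b t x)
    (hT : ENNReal.ofReal t₁ < T)
    (hX : ∀ t ∈ Icc 0 t₁, HasDerivWithinAt X (c t (X t)) (Icc 0 t₁) t) (ht : t ∈ Icc 0 t₁) :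
    HasDerivWithinAt (fun t => dx f t (X t))
      (dx b t (X t) - dx c t (X t) * dx f t (X t)) (Icc 0 t₁) t := by
  have hin : ∀ t ∈ Icc 0 t₁, ∀ y, (t, y) ∈ strip T := fun t ht => mem_strip_of_mem_Icc hT ht
  have hXc : ContinuousOn X (Icc 0 t₁) := fun t ht => (hX t ht).continuousWithinAt
  have hfx := continuousOn_dx hf
  obtain ⟨F, hF⟩ := exists_abs_le_near_curve hfx hT hXc
  obtain ⟨C, hC⟩ := exists_abs_diffQuot_le_near_curve hc hT hXc
  obtain ⟨B, hB⟩ := exists_abs_diffQuot_le_near_curve hb hT hXc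
  refine hasDerivWithinAt_of_tendsto (l := 𝓝[>] 0) (C := B + C * F)
    (g := fun h t => diffQuot f h t (X t))
    (G := fun h t => diffQuot b h t (X t) - diffQuot c h t (X t) * dx f t (X t + h))
    (W := fun t => dx b t (X t) - dx c t (X t) * dx f t (X t))
    (.of_forall fun h t ht => hasDerivWithinAt_diffQuot_of_transport hf heq hT hX h ht)
    (.of_forall fun h => ?_) ?_ (fun t ht => tendsto_diffQuot hf (hin t ht _))
    (fun t ht => ?_) ?_ ht
  · exact (continuousOn_diffQuot_along hb hT hXc h).sub
      ((continuousOn_diffQuot_along hc hT hXc h).mul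
        (continuousOn_along hfx hT (hXc.add continuousOn_const)))
  · filter_upwards [Ioc_mem_nhdsGT one_pos] with h hh t ht
    have hCF : |diffQuot c h t (X t) * dx f t (X t + h)| ≤ C * F := by
      rw [abs_mul]
      exact mul_le_mul (hC t ht h hh) (hF t ht h (Ioc_subset_Icc_self hh)) (abs_nonneg _)
        ((abs_nonneg _).trans (hC t ht h hh))
    exact (abs_sub _ _).trans (add_le_add (hB t ht h hh) hCF)
  · have hshift : Tendsto (fun h => dx f t (X t + h)) (𝓝[>] 0) (𝓝 (dx f t (X t))) := by
      have hcont : Continuous (dx f t) :=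
        (contDiff_slice hf (hin t ht 0)).continuous_deriv le_rfl
      simpa [Function.comp_def] using
        ((hcont.comp (continuous_const_add (X t))).tendsto 0).mono_left nhdsWithin_le_nhds
    exact (tendsto_diffQuot hb (hin t ht _)).sub
      ((tendsto_diffQuot hc (hin t ht _)).mul hshift)
  · exact (continuousOn_along (continuousOn_dx hb) hT hXc).sub
      ((continuousOn_along (continuousOn_dx hc) hT hXc).mul (continuousOn_along hfx hT hXc))

end DifferenceQuotient

/-- The sound speed `c(u) = √(-p'(u)) = u^{-(γ+1)/2}`. -/
def sound (γ u : ℝ) : ℝ := u ^ (-(γ + 1) / 2)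

/-- The damping coefficient `λ / (1+t)^μ`. -/
def damping (lam μ t : ℝ) : ℝ := lam / (1 + t) ^ μ

/-- The solution `E` of `E' = -λ/(1+t)^μ E`, `E(0) = 1`. -/
def dampingFactor (lam μ t : ℝ) : ℝ := Real.exp (-∫ τ in (0 : ℝ)..t, damping lam μ τ)

/-- The weight `√c(u)`, which turns the equation for the slope of a Riemann invariant along its
characteristics into a Riccati equation without terms in `u_x` and `v_x`. -/
def weight (γ u : ℝ) : ℝ := u ^ (-(γ + 1) / 4)

/-- A primitive of the weight. -/
def weightPrimitive (γ u : ℝ) : ℝ := ∫ ξ in (1 : ℝ)..u, weight γ ξ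

section Calculus

variable {γ lam μ u t : ℝ}

lemma weight_pos (hu : 0 < u) : 0 < weight γ u := Real.rpow_pos_of_pos hu _

lemma sound_sq (hu : 0 < u) : sound γ u ^ 2 = u ^ (-(γ + 1)) := by
  rw [sound, ← Real.rpow_natCast, ← Real.rpow_mul hu.le]
  congr 1
  push_cast
  ring

lemma eta_pos (hγ : 1 < γ) (hu : 0 < u) : 0 < eta γ u :=
  mul_pos (div_pos two_pos (sub_pos.2 hγ)) (Real.rpow_pos_of_pos hu _)

lemma strictAntiOn_eta (hγ : 1 < γ) : StrictAntiOn (eta γ) (Ioi 0) := fun _ hu _ _ huw =>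
  mul_lt_mul_of_pos_left (Real.rpow_lt_rpow_of_neg hu huw (by linarith))
    (div_pos two_pos (sub_pos.2 hγ))

lemma exists_eta_eq (hγ : 1 < γ) {y : ℝ} (hy : 0 < y) : ∃ u > 0, eta γ u = y := by
  have hγ' : 0 < γ - 1 := sub_pos.2 hγ
  have hexp : -2 / (γ - 1) * (-(γ - 1) / 2) = 1 := by field_simp
  refine ⟨(y * (γ - 1) / 2) ^ (-2 / (γ - 1)), by positivity, ?_⟩
  rw [eta, ← Real.rpow_mul (by positivity), hexp, Real.rpow_one]
  field_simp

lemma hasDerivAt_eta (hγ : γ ≠ 1) (hu : 0 < u) : HasDerivAt (eta γ) (-sound γ u) u := by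
  refine ((Real.hasDerivAt_rpow_const (Or.inl hu.ne')).const_mul (2 / (γ - 1))).congr_deriv ?_
  have hexp : -(γ - 1) / 2 - 1 = -(γ + 1) / 2 := by ring
  have hγ' : γ - 1 ≠ 0 := sub_ne_zero.2 hγ
  rw [hexp, sound]
  field_simp

lemma hasDerivAt_pressure (hγ : γ ≠ 0) (hu : 0 < u) :
    HasDerivAt (pressure γ) (-sound γ u ^ 2) u := by
  refine ((Real.hasDerivAt_rpow_const (Or.inl hu.ne')).div_const γ).congr_deriv ?_
  rw [sound_sq hu, neg_add']
  field_simp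

lemma hasDerivAt_sound (hu : 0 < u) :
    HasDerivAt (sound γ) (-(γ + 1) / 2 * (sound γ u / u)) u :=
  (Real.hasDerivAt_rpow_const (Or.inl hu.ne')).congr_deriv (by rw [Real.rpow_sub_one hu.ne', sound])

lemma hasDerivAt_weight (hu : 0 < u) :
    HasDerivAt (weight γ) (-(γ + 1) / 4 * (weight γ u / u)) u :=
  (Real.hasDerivAt_rpow_const (Or.inl hu.ne')).congr_deriv
    (by rw [Real.rpow_sub_one hu.ne', weight])

lemma continuousOn_weight : ContinuousOn (weight γ) (Ioi 0) := fun _ hu =>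
  (hasDerivAt_weight hu).continuousAt.continuousWithinAt

lemma hasDerivAt_weightPrimitive (hu : 0 < u) :
    HasDerivAt (weightPrimitive γ) (weight γ u) u := by
  have hmeas : StronglyMeasurableAtFilter (weight γ) (𝓝 u) :=
    continuousOn_weight.stronglyMeasurableAtFilter isOpen_Ioi u hu
  exact intervalIntegral.integral_hasDerivAt_right
    (intervalIntegral.intervalIntegrable_rpow (Or.inr (notMem_uIcc_of_lt one_pos hu)))
    hmeas (hasDerivAt_weight hu).continuousAt

lemma exists_le_of_abs_deriv_pressure_le (hγ : 0 < γ) (C : ℝ) :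
    ∃ d > 0, ∀ u > 0, |deriv (pressure γ) u| ≤ C → d ≤ u := by
  have hM : 0 < max C 1 := lt_max_of_lt_right one_pos
  refine ⟨(max C 1) ^ (-(γ + 1))⁻¹, Real.rpow_pos_of_pos hM _, fun u hu hC => ?_⟩
  rw [(hasDerivAt_pressure hγ.ne' hu).deriv, abs_neg, abs_sq, sound_sq hu] at hC
  exact (Real.rpow_inv_le_iff_of_neg hM hu (by linarith)).2 (le_max_of_le_left hC)

lemma damping_nonneg (hlam : 0 ≤ lam) (ht : 0 ≤ t) : 0 ≤ damping lam μ t :=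
  div_nonneg hlam (Real.rpow_nonneg (by linarith) _)

lemma hasDerivAt_damping (ht : -1 < t) :
    HasDerivAt (damping lam μ) (-(lam * μ) * (1 + t) ^ (-μ - 1)) t := by
  have hpow := (((hasDerivAt_id' t).const_add 1).rpow_const (p := -μ)
    (Or.inl (by linarith))).const_mul lam
  refine (hpow.congr_deriv (by ring)).congr_of_eventuallyEq ?_
  filter_upwards [lt_mem_nhds ht] with τ hτ
  rw [damping, Real.rpow_neg (by linarith), div_eq_mul_inv]

lemma contDiffOn_damping : ContDiffOn ℝ 1 (damping lam μ) (Ioi (-1)) := by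
  have hpos : ∀ t ∈ Ioi (-1 : ℝ), 0 < 1 + t := fun t ht => neg_lt_iff_pos_add'.1 ht
  exact contDiffOn_const.div
    ((contDiffOn_const.add contDiffOn_id).rpow_const_of_ne fun t ht => (hpos t ht).ne')
    fun t ht => (Real.rpow_pos_of_pos (hpos t ht) μ).ne'

lemma exists_abs_damping_le (lam μ B : ℝ) : ∃ C, ∀ t ∈ Icc 0 B, |damping lam μ t| ≤ C :=
  isCompact_Icc.exists_bound_of_continuousOn
    (contDiffOn_damping.continuousOn.mono fun _ ht => neg_one_lt_zero.trans_le ht.1)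

lemma dampingFactor_zero : dampingFactor lam μ 0 = 1 := by simp [dampingFactor]

lemma abs_dampingFactor_le_one (hlam : 0 ≤ lam) (ht : 0 ≤ t) : |dampingFactor lam μ t| ≤ 1 := by
  rw [dampingFactor, Real.abs_exp, Real.exp_le_one_iff, neg_nonpos]
  exact intervalIntegral.integral_nonneg ht fun τ hτ => damping_nonneg hlam hτ.1

lemma hasDerivAt_dampingFactor (ht : 0 ≤ t) :
    HasDerivAt (dampingFactor lam μ) (-damping lam μ t * dampingFactor lam μ t) t := by
  have ht' : t ∈ Ioi (-1 : ℝ) := neg_one_lt_zero.trans_le ht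
  have hint : IntervalIntegrable (damping lam μ) MeasureTheory.volume 0 t :=
    (contDiffOn_damping.continuousOn.mono fun τ hτ =>
      neg_one_lt_zero.trans_le hτ.1).intervalIntegrable_of_Icc ht
  have hderiv := intervalIntegral.integral_hasDerivAt_right hint
    (contDiffOn_damping.continuousOn.stronglyMeasurableAtFilter isOpen_Ioi t ht')
    (hasDerivAt_damping ht').continuousAt
  exact hderiv.neg.exp.congr_deriv (mul_comm _ _)

end Calculus

/-- The Riemann invariant `v - ε η(u)` of functions of `(t, x)`; for `ε = 1` it is `r`, for
`ε = -1` it is `s`. It is transported with speed `-ε c(u)`. -/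
def riemann (γ ε : ℝ) (u v : ℝ → ℝ → ℝ) (t x : ℝ) : ℝ := v t x - ε * eta γ (u t x)

section Equations

variable {γ lam μ ε t t₁ x : ℝ} {u₀ v₀ : ℝ → ℝ} {T : ENNReal} {u v : ℝ → ℝ → ℝ}

lemma contDiffOn_rpow_Ioi (k : ℝ) : ContDiffOn ℝ 1 (fun u : ℝ => u ^ k) (Ioi 0) :=
  contDiffOn_id.rpow_const_of_ne fun _ hu => ne_of_gt hu

lemma riemann_one : riemann γ 1 u v t = riemannR γ (u t) (v t) := by
  ext x
  rw [riemann, riemannR, one_mul]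

lemma riemann_neg_one : riemann γ (-1) u v t = riemannS γ (u t) (v t) := by
  ext x
  rw [riemann, riemannS, neg_one_mul, sub_neg_eq_add]

namespace IsClassicalSolution

variable (h : IsClassicalSolution γ lam μ u₀ v₀ T u v)
include h

lemma contDiffOn_comp {F : ℝ → ℝ} (hF : ContDiffOn ℝ 1 F (Ioi 0)) :
    ContDiffOn ℝ 1 (uncurry fun t x => F (u t x)) (strip T) :=
  hF.comp h.u_c1 fun q hq => h.u_pos q.1 q.2 hq

lemma contDiffOn_riemann (ε : ℝ) : ContDiffOn ℝ 1 (uncurry (riemann γ ε u v)) (strip T) :=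
  h.v_c1.sub (contDiffOn_const.mul (contDiffOn_const.mul (h.contDiffOn_comp
    (contDiffOn_rpow_Ioi _))))

lemma dx_comp {F : ℝ → ℝ} {F' : ℝ} (hq : (t, x) ∈ strip T) (hF : HasDerivAt F F' (u t x)) :
    dx (fun t x => F (u t x)) t x = F' * dx u t x :=
  (hF.comp x (hasDerivAt_dx h.u_c1 hq)).deriv

lemma dx_riemann (hγ : γ ≠ 1) (hq : (t, x) ∈ strip T) :
    dx (riemann γ ε u v) t x = dx v t x + ε * sound γ (u t x) * dx u t x := by
  have hη := (hasDerivAt_eta hγ (h.u_pos t x hq)).comp x (hasDerivAt_dx h.u_c1 hq)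
  exact ((hasDerivAt_dx h.v_c1 hq).sub (hη.const_mul ε)).deriv.trans (by ring)

lemma dt_riemann (hγ : γ ≠ 1) (hq : (t, x) ∈ strip T) :
    dt (riemann γ ε u v) t x = dt v t x + ε * sound γ (u t x) * dt u t x := by
  have hη := (hasDerivAt_eta hγ (h.u_pos t x hq)).comp_hasDerivWithinAt t
    (hasDerivWithinAt_dt h.u_c1 hq)
  exact (((hasDerivWithinAt_dt h.v_c1 hq).sub (hη.const_mul ε)).derivWithin
    (uniqueDiffOn_Ici 0 t hq.1)).trans (by ring)

lemma riemann_transport (hγ : 1 < γ) (hε : |ε| = 1) (hq : (t, x) ∈ strip T) :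
    dt (riemann γ ε u v) t x + -ε * sound γ (u t x) * dx (riemann γ ε u v) t x =
      -damping lam μ t * v t x := by
  have hε' : ε ^ 2 = 1 := by rw [← sq_abs, hε, one_pow]
  have hmass := h.mass t x hq
  have hmom := h.momentum t x hq
  rw [h.dx_comp hq (hasDerivAt_pressure (by positivity) (h.u_pos t x hq))] at hmom
  rw [h.dt_riemann hγ.ne' hq, h.dx_riemann hγ.ne' hq, damping]
  linear_combination hmom + ε * sound γ (u t x) * hmass - sound γ (u t x) ^ 2 * dx u t x * hε'

end IsClassicalSolution

namespace IsSolution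

variable (h : IsSolution γ lam μ u₀ v₀ T u v)
include h

lemma exists_bound (hγ : 0 < γ) (hT : ENNReal.ofReal t₁ < T) :
    ∃ C, ∃ d > 0, ∀ t ∈ Icc 0 t₁, ∀ x,
      u t x ∈ Icc d C ∧ |v t x| ≤ C ∧ |dx u t x| ≤ C ∧ |dx v t x| ≤ C := by
  obtain ⟨T', hT', hT'T⟩ := exists_between hT
  obtain ⟨C, hC⟩ := h.bounded T' hT'T
  obtain ⟨d, hd, hdC⟩ := exists_le_of_abs_deriv_pressure_le hγ C
  refine ⟨C, d, hd, fun t ht x => ?_⟩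
  obtain ⟨hu, hv, -, -, hux, hvx, hp⟩ := hC t x (mem_strip_of_mem_Icc hT' ht x)
  have hpos := h.classical.u_pos t x (mem_strip_of_mem_Icc hT ht x)
  exact ⟨⟨hdC _ hpos hp, (le_abs_self _).trans hu⟩, hv, hux, hvx⟩

lemma exists_abs_comp_le (hγ : 0 < γ) (hT : ENNReal.ofReal t₁ < T) {F : ℝ → ℝ}
    (hF : ContinuousOn F (Ioi 0)) : ∃ C, ∀ t ∈ Icc 0 t₁, ∀ x, |F (u t x)| ≤ C := by
  obtain ⟨C, d, hd, hC⟩ := h.exists_bound hγ hT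
  obtain ⟨A, hA⟩ := isCompact_Icc.exists_bound_of_continuousOn
    (hF.mono fun u (hu : u ∈ Icc d C) => hd.trans_le hu.1)
  exact ⟨A, fun t ht x => hA _ (hC t ht x).1⟩

lemma exists_abs_riemann_le (hγ : 0 < γ) (hT : ENNReal.ofReal t₁ < T) (ε : ℝ) :
    ∃ C, ∀ t ∈ Icc 0 t₁, ∀ x, |riemann γ ε u v t x| ≤ C := by
  obtain ⟨C, d, -, hC⟩ := h.exists_bound hγ hT
  obtain ⟨A, hA⟩ := h.exists_abs_comp_le hγ hT (F := fun u => ε * eta γ u)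
    (continuousOn_const.mul (continuousOn_const.mul (contDiffOn_rpow_Ioi _).continuousOn))
  exact ⟨C + A, fun t ht x =>
    (abs_sub _ _).trans (add_le_add (hC t ht x).2.1 (hA t ht x))⟩

lemma exists_characteristic (hγ : 0 < γ) (hT : ENNReal.ofReal t₁ < T) {F : ℝ → ℝ}
    (hF : ContDiffOn ℝ 1 F (Ioi 0)) {t₀ : ℝ} (ht₀ : t₀ ∈ Icc 0 t₁) (x₀ : ℝ) :
    ∃ X : ℝ → ℝ, X t₀ = x₀ ∧
      ∀ t ∈ Icc 0 t₁, HasDerivWithinAt X (F (u t (X t))) (Icc 0 t₁) t := by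
  obtain ⟨C, d, -, hC⟩ := h.exists_bound hγ hT
  obtain ⟨A, hA⟩ := h.exists_abs_comp_le hγ hT hF.continuousOn
  obtain ⟨A', hA'⟩ := h.exists_abs_comp_le hγ hT
    (hF.continuousOn_deriv_of_isOpen isOpen_Ioi le_rfl)
  refine exists_characteristic_of_abs_le (h.classical.contDiffOn_comp hF) hT hA
    (L := A' * C) (fun t ht x => ?_) ht₀ x₀
  have hq := mem_strip_of_mem_Icc hT ht x
  have hderiv : HasDerivAt F (deriv F (u t x)) (u t x) :=
    ((hF.differentiableOn one_ne_zero).differentiableAt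
      (isOpen_Ioi.mem_nhds (h.classical.u_pos t x hq))).hasDerivAt
  rw [h.classical.dx_comp hq hderiv, abs_mul]
  exact mul_le_mul (hA' t ht x) (hC t ht x).2.2.1 (abs_nonneg _) ((abs_nonneg _).trans (hA' t ht x))

end IsSolution

end Equations

section Relaxation

variable {g h b : ℝ → ℝ} {t κ S D : ℝ}

lemma le_of_relaxation (ht : 0 ≤ t)
    (hg : ∀ τ ∈ Icc 0 t, HasDerivWithinAt g (-b τ * (g τ + h τ)) (Icc 0 t) τ)
    (hb : ∀ τ ∈ Icc 0 t, b τ ∈ Icc 0 κ) (hgS : ∀ τ ∈ Icc 0 t, g τ ≤ S)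
    (hhS : ∀ τ ∈ Icc 0 t, -S ≤ h τ) (h0 : g 0 ≤ D) :
    g t ≤ S - (S - D) * Real.exp (-(κ * t)) := by
  have hslope : ∀ τ ∈ Ico 0 t, ∀ r, -b τ * (g τ + h τ) < r →
      ∃ᶠ z in 𝓝[>] τ, (z - τ)⁻¹ * ((g z - S) - (g τ - S)) < r := fun τ hτ r hr =>
    (((hg τ (Ico_subset_Icc_self hτ)).sub_const S).mono_of_mem_nhdsWithin
      (Icc_mem_nhdsGE_of_mem hτ)).liminf_right_slope_le hr
  have hbound : ∀ τ ∈ Ico 0 t, -b τ * (g τ + h τ) ≤ -κ * (g τ - S) + 0 := fun τ hτ => by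
    have hτ := Ico_subset_Icc_self hτ
    have hκb : 0 ≤ (κ - b τ) * (S - g τ) :=
      mul_nonneg (sub_nonneg.2 (hb τ hτ).2) (sub_nonneg.2 (hgS τ hτ))
    have hbh : 0 ≤ b τ * (h τ + S) := mul_nonneg (hb τ hτ).1 (by linarith [hhS τ hτ])
    linarith
  have hgronwall := le_gronwallBound_of_liminf_deriv_right_le (f := fun τ => g τ - S)
    (fun τ hτ => (hg τ hτ).continuousWithinAt.sub continuousWithinAt_const) hslope
    (sub_le_sub_right h0 S) hbound t (right_mem_Icc.2 ht)
  rw [gronwallBound_ε0, sub_zero, neg_mul] at hgronwall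
  linarith

lemma abs_le_of_relaxation (ht : 0 ≤ t)
    (hg : ∀ τ ∈ Icc 0 t, HasDerivWithinAt g (-b τ * (g τ + h τ)) (Icc 0 t) τ)
    (hb : ∀ τ ∈ Icc 0 t, b τ ∈ Icc 0 κ) (hgS : ∀ τ ∈ Icc 0 t, |g τ| ≤ S)
    (hhS : ∀ τ ∈ Icc 0 t, |h τ| ≤ S) (h0 : |g 0| ≤ D) :
    |g t| ≤ S - (S - D) * Real.exp (-(κ * t)) := by
  refine abs_le'.2 ⟨le_of_relaxation ht hg hb (fun τ hτ => (abs_le.1 (hgS τ hτ)).2)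
    (fun τ hτ => (abs_le.1 (hhS τ hτ)).1) (abs_le.1 h0).2, ?_⟩
  exact le_of_relaxation (g := fun τ => -g τ) (h := fun τ => -h τ) ht
    (fun τ hτ => (hg τ hτ).neg.congr_deriv (by ring)) hb
    (fun τ hτ => neg_le.1 (abs_le.1 (hgS τ hτ)).1)
    (fun τ hτ => neg_le_neg (abs_le.1 (hhS τ hτ)).2) (neg_le.1 (abs_le.1 h0).1)

lemma mem_upperBounds_of_contraction {P : Set ℝ} {θ : ℝ} (hP : BddAbove P) (hθ : 0 < θ)
    (hcontr : ∀ S ∈ upperBounds P, D ≤ S → S - (S - D) * θ ∈ upperBounds P) :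
    D ∈ upperBounds P := by
  rcases P.eq_empty_or_nonempty with rfl | hne
  · simp
  suffices sSup P ≤ D from fun p hp => (le_csSup hP hp).trans this
  by_contra! hlt
  have hle : sSup P ≤ sSup P - (sSup P - D) * θ :=
    csSup_le hne (hcontr _ (fun p hp => le_csSup hP hp) hlt.le)
  linarith [mul_pos (sub_pos.2 hlt) hθ]

end Relaxation

/-- The Riemann invariant of `(u, v)` relative to that of the `x`-independent reference state with
velocity `w t` and `η = k`. -/
def relRiemann (γ k : ℝ) (w : ℝ → ℝ) (ε : ℝ) (u v : ℝ → ℝ → ℝ) (t x : ℝ) : ℝ :=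
  riemann γ ε u v t x - (w t - ε * k)

section MaximumPrinciple

variable {γ lam μ ε k t t₁ x D S : ℝ} {u₀ v₀ w : ℝ → ℝ} {T : ENNReal} {u v : ℝ → ℝ → ℝ}

namespace IsSolution

variable (h : IsSolution γ lam μ u₀ v₀ T u v)
include h

lemma exists_abs_relRiemann_le (hγ : 0 < γ) (hT : ENNReal.ofReal t₁ < T)
    (hw : ContinuousOn w (Icc 0 t₁)) (k ε : ℝ) :
    ∃ C, ∀ t ∈ Icc 0 t₁, ∀ x, |relRiemann γ k w ε u v t x| ≤ C := by
  obtain ⟨C, hC⟩ := h.exists_abs_riemann_le hγ hT ε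
  obtain ⟨A, hA⟩ := isCompact_Icc.exists_bound_of_continuousOn hw
  exact ⟨C + (A + |ε * k|), fun t ht x => (abs_sub _ _).trans
    (add_le_add (hC t ht x) ((abs_sub _ _).trans (add_le_add_left (hA t ht) _)))⟩

lemma hasDerivWithinAt_relRiemann (hγ : 1 < γ) (hε : |ε| = 1) (hT : ENNReal.ofReal t₁ < T)
    {X : ℝ → ℝ} (hX : ∀ t ∈ Icc 0 t₁, HasDerivWithinAt X (-ε * sound γ (u t (X t))) (Icc 0 t₁) t)
    (ht : t ∈ Icc 0 t₁) (hw : HasDerivAt w (-damping lam μ t * w t) t) :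
    HasDerivWithinAt (fun t => relRiemann γ k w ε u v t (X t))
      (-(damping lam μ t / 2) *
        (relRiemann γ k w ε u v t (X t) + relRiemann γ k w (-ε) u v t (X t))) (Icc 0 t₁) t := by
  have hin : ∀ t ∈ Icc 0 t₁, (t, X t) ∈ strip T := fun t ht => mem_strip_of_mem_Icc hT ht _
  have hr := hasDerivWithinAt_comp_curve (h.classical.contDiffOn_riemann ε) ht hin (hX t ht)
  rw [h.classical.riemann_transport hγ hε (hin t ht)] at hr
  refine (hr.sub (hw.hasDerivWithinAt.sub_const (ε * k))).congr_deriv ?_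
  simp only [relRiemann, riemann]
  ring

lemma abs_relRiemann_le_of_le (hγ : 1 < γ) (hlam : 0 ≤ lam) (ht : 0 ≤ t)
    (hT : ENNReal.ofReal t < T) {κ : ℝ} (hκ : ∀ τ ∈ Icc 0 t, damping lam μ τ / 2 ≤ κ)
    (hw : ∀ t ≥ 0, HasDerivAt w (-damping lam μ t * w t) t)
    (hS : ∀ ε : ℝ, |ε| = 1 → ∀ τ ∈ Icc 0 t, ∀ x, |relRiemann γ k w ε u v τ x| ≤ S)
    (hD : ∀ x, |relRiemann γ k w ε u v 0 x| ≤ D) (hε : |ε| = 1) (x : ℝ) :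
    |relRiemann γ k w ε u v t x| ≤ S - (S - D) * Real.exp (-(κ * t)) := by
  obtain ⟨X, rfl, hX⟩ := h.exists_characteristic (one_pos.trans hγ) hT
    (F := fun u => -ε * sound γ u) (contDiffOn_const.mul (contDiffOn_rpow_Ioi _))
    (right_mem_Icc.2 ht) x
  exact abs_le_of_relaxation (g := fun τ => relRiemann γ k w ε u v τ (X τ))
    (h := fun τ => relRiemann γ k w (-ε) u v τ (X τ)) (b := fun τ => damping lam μ τ / 2) ht
    (fun τ hτ => h.hasDerivWithinAt_relRiemann hγ hε hT hX hτ (hw τ hτ.1))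
    (fun τ hτ => ⟨div_nonneg (damping_nonneg hlam hτ.1) two_pos.le, hκ τ hτ⟩)
    (fun τ hτ => hS ε hε τ hτ _) (fun τ hτ => hS (-ε) (by rwa [abs_neg]) τ hτ _) (hD _)

theorem abs_relRiemann_le (hγ : 1 < γ) (hlam : 0 ≤ lam)
    (hw : ∀ t ≥ 0, HasDerivAt w (-damping lam μ t * w t) t)
    (hD : ∀ ε : ℝ, |ε| = 1 → ∀ x, |relRiemann γ k w ε u v 0 x| ≤ D)
    (ht : 0 ≤ t) (hT : ENNReal.ofReal t < T) (hε : |ε| = 1) (x : ℝ) :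
    |relRiemann γ k w ε u v t x| ≤ D := by
  obtain ⟨κ, hκ⟩ := exists_abs_damping_le lam μ t
  let P : Set ℝ := {p | ∃ ε : ℝ, |ε| = 1 ∧ ∃ τ ∈ Icc 0 t, ∃ x, |relRiemann γ k w ε u v τ x| = p}
  suffices D ∈ upperBounds P from this ⟨ε, hε, t, right_mem_Icc.2 ht, x, rfl⟩
  have hP : BddAbove P := by
    have hwc : ContinuousOn w (Icc 0 t) := fun τ hτ =>
      (hw τ hτ.1).continuousAt.continuousWithinAt
    choose C hC using h.exists_abs_relRiemann_le (one_pos.trans hγ) hT hwc k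
    refine ⟨max (C 1) (C (-1)), ?_⟩
    rintro _ ⟨ε, hε, τ, hτ, x, rfl⟩
    rcases eq_or_eq_neg_of_abs_eq hε with rfl | rfl
    · exact (hC 1 τ hτ x).trans (le_max_left _ _)
    · exact (hC (-1) τ hτ x).trans (le_max_right _ _)
  have hκ0 : 0 ≤ κ := (abs_nonneg _).trans (hκ 0 (left_mem_Icc.2 ht))
  refine mem_upperBounds_of_contraction hP (Real.exp_pos (-(κ * t))) fun S hS hDS => ?_
  rintro _ ⟨ε, hε, τ, hτ, x, rfl⟩
  have hle := h.abs_relRiemann_le_of_le hγ hlam hτ.1 ((ENNReal.ofReal_le_ofReal hτ.2).trans_lt hT)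
    (fun σ hσ => ((half_le_self (damping_nonneg hlam hσ.1)).trans (le_abs_self _)).trans
      (hκ σ ⟨hσ.1, hσ.2.trans hτ.2⟩)) hw
    (fun ε hε σ hσ x => hS ⟨ε, hε, σ, ⟨hσ.1, hσ.2.trans hτ.2⟩, x, rfl⟩) (hD ε hε) hε x
  refine hle.trans (sub_le_sub_left (mul_le_mul_of_nonneg_left ?_ (sub_nonneg.2 hDS)) S)
  exact Real.exp_le_exp.2 (neg_le_neg (mul_le_mul_of_nonneg_left hτ.2 hκ0))

end IsSolution

end MaximumPrinciple

section UniformBounds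

variable {γ lam μ m δ t D : ℝ} {u₀ v₀ : ℝ → ℝ} {T : ENNReal} {u v : ℝ → ℝ → ℝ}

lemma InX.mem_Icc {u v : ℝ → ℝ} (h : InX m δ u v) (x : ℝ) : u x ∈ Icc δ m :=
  ⟨h.le_u x, (le_abs_self _).trans
    ((le_add_of_nonneg_right (abs_nonneg _)).trans (h.norm_le x x))⟩

lemma IsSolution.inX (h : IsSolution γ lam μ u₀ v₀ T u v) (hγ : 0 < γ) (ht : 0 ≤ t)
    (hT : ENNReal.ofReal t < T) {U V : ℝ} (hu : ∀ x, u t x ∈ Icc δ U) (hv : ∀ x, |v t x| ≤ V) :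
    InX (U + V) δ (u t) (v t) := by
  obtain ⟨C, d, -, hC⟩ := h.exists_bound hγ hT
  replace hC := hC t (right_mem_Icc.2 ht)
  have hu' : ∀ x, |u t x| ≤ U := fun x => by
    rw [abs_of_pos (h.classical.u_pos t x ⟨ht, hT⟩)]
    exact (hu x).2
  exact ⟨⟨contDiff_slice (x := 0) h.classical.u_c1 ⟨ht, hT⟩, ⟨U, hu'⟩, C, fun x => (hC x).2.2.1⟩,
    ⟨contDiff_slice (x := 0) h.classical.v_c1 ⟨ht, hT⟩, ⟨V, hv⟩, C, fun x => (hC x).2.2.2⟩,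
    fun x y => add_le_add (hu' x) (hv y), fun x => (hu x).1⟩

lemma IsClassicalSolution.riemann_one_zero (h : IsClassicalSolution γ lam μ u₀ v₀ T u v) :
    riemann γ 1 u v 0 = riemannR γ u₀ v₀ := by
  rw [riemann_one, funext h.u_init, funext h.v_init]

lemma IsClassicalSolution.riemann_neg_one_zero (h : IsClassicalSolution γ lam μ u₀ v₀ T u v) :
    riemann γ (-1) u v 0 = riemannS γ u₀ v₀ := by
  rw [riemann_neg_one, funext h.u_init, funext h.v_init]

-- The reference state carries the velocity of the data at `x₁` with the opposite sign, so that the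
-- relative Riemann invariants of the data at `x` are `s(0,x₁) + r(0,x)` and `s(0,x) + r(0,x₁)`.
lemma IsSolution.abs_sub_reference_le (h : IsSolution γ lam μ u₀ v₀ T u v) (hγ : 1 < γ)
    (hlam : 0 ≤ lam) (hD : ∀ x y, |riemannS γ u₀ v₀ x + riemannR γ u₀ v₀ y| ≤ D) (x₁ : ℝ)
    (ht : 0 ≤ t) (hT : ENNReal.ofReal t < T) (x : ℝ) :
    |v t x + dampingFactor lam μ t * v₀ x₁| ≤ D ∧ |eta γ (u t x) - eta γ (u₀ x₁)| ≤ D := by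
  have hw : ∀ t ≥ 0, HasDerivAt (fun t => -(dampingFactor lam μ t * v₀ x₁))
      (-damping lam μ t * -(dampingFactor lam μ t * v₀ x₁)) t := fun t ht =>
    ((hasDerivAt_dampingFactor ht).mul_const (v₀ x₁)).fun_neg.congr_deriv (by ring)
  have hinit : ∀ ε : ℝ, |ε| = 1 → ∀ x, |relRiemann γ (eta γ (u₀ x₁))
      (fun t => -(dampingFactor lam μ t * v₀ x₁)) ε u v 0 x| ≤ D := fun ε hε x => by
    rcases eq_or_eq_neg_of_abs_eq hε with rfl | rfl
    · rw [relRiemann, h.classical.riemann_one_zero, dampingFactor_zero]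
      convert hD x₁ x using 2
      rw [riemannS]
      ring
    · rw [relRiemann, h.classical.riemann_neg_one_zero, dampingFactor_zero]
      convert hD x x₁ using 2
      rw [riemannR]
      ring
  have hr := abs_le.1 (h.abs_relRiemann_le hγ hlam hw hinit ht hT abs_one x)
  have hs := abs_le.1 (h.abs_relRiemann_le hγ hlam hw hinit ht hT
    (abs_neg (1 : ℝ) ▸ abs_one) x)
  simp only [relRiemann, riemann] at hr hs
  exact ⟨abs_le.2 ⟨by linarith, by linarith⟩, abs_le.2 ⟨by linarith, by linarith⟩⟩

theorem exists_uniform_bounds (lam μ : ℝ) (hγ : 1 < γ) (hlam : 0 ≤ lam) (hm : 0 < m)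
    (hδ : 0 < δ) :
    ∃ m₁ > 0, ∃ δ₁ > 0, ∀ (u₀ v₀ : ℝ → ℝ) (x₁ D : ℝ), InX m δ u₀ v₀ →
      D < eta γ (u₀ x₁) / 2 → (∀ x y, |riemannS γ u₀ v₀ x + riemannR γ u₀ v₀ y| ≤ D) →
      ∀ (T : ENNReal) (u v : ℝ → ℝ → ℝ), IsSolution γ lam μ u₀ v₀ T u v →
        ∀ t : ℝ, 0 ≤ t → ENNReal.ofReal t < T → InX m₁ δ₁ (u t) (v t) := by
  have hηδ := eta_pos hγ hδ
  have hη := strictAntiOn_eta hγ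
  obtain ⟨δ₁, hδ₁, hδη⟩ := exists_eta_eq hγ (mul_pos two_pos hηδ)
  obtain ⟨U, hU, hUη⟩ := exists_eta_eq hγ (half_pos (eta_pos hγ hm))
  refine ⟨U + (eta γ δ + m), by positivity, δ₁, hδ₁, ?_⟩
  intro u₀ v₀ x₁ D hX hDη hD T u v h t ht hT
  have hu₁ : 0 < u₀ x₁ := hδ.trans_le (hX.le_u x₁)
  have hv₁m : |v₀ x₁| ≤ m := (le_add_of_nonneg_left (abs_nonneg _)).trans (hX.norm_le x₁ x₁)
  have hη₁δ : eta γ (u₀ x₁) ≤ eta γ δ := (hη.le_iff_ge hu₁ hδ).2 (hX.le_u x₁)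
  have hη₁m : eta γ m ≤ eta γ (u₀ x₁) := (hη.le_iff_ge hm hu₁).2 (hX.mem_Icc x₁).2
  refine h.inX (one_pos.trans hγ) ht hT (fun x => ?_) fun x => ?_
  · have hpos : 0 < u t x := h.classical.u_pos t x ⟨ht, hT⟩
    have hux := abs_le.1 (h.abs_sub_reference_le hγ hlam hD x₁ ht hT x).2
    exact ⟨(hη.le_iff_ge hpos hδ₁).1 (by linarith), (hη.le_iff_ge hU hpos).1 (by linarith)⟩
  · have hvx := (h.abs_sub_reference_le hγ hlam hD x₁ ht hT x).1
    have hw : |dampingFactor lam μ t * v₀ x₁| ≤ m := by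
      rw [abs_mul]
      exact (mul_le_of_le_one_left (abs_nonneg _) (abs_dampingFactor_le_one hlam ht)).trans hv₁m
    rw [abs_le] at hvx hw ⊢
    constructor <;> linarith

lemma exists_lt_half_eta {uminus : ℝ} (hu : 0 < uminus) (hlim : Tendsto u₀ atBot (𝓝 uminus))
    (hD : D < 1 / (γ - 1) * uminus ^ (-(γ - 1) / 2)) : ∃ x₁, D < eta γ (u₀ x₁) / 2 := by
  have hη : Tendsto (fun x => eta γ (u₀ x) / 2) atBot (𝓝 (eta γ uminus / 2)) :=
    ((hlim.rpow_const (Or.inl hu.ne')).const_mul (2 / (γ - 1))).div_const 2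
  refine (hη.eventually_const_lt (hD.trans_eq ?_)).exists
  rw [eta]
  ring

end UniformBounds

section Riccati

variable {Z Z' : ℝ → ℝ} {κ C K t : ℝ}

lemma le_neg_of_riccati_le (hC : C < κ * K ^ 2)
    (hZ : ∀ τ ∈ Icc 0 t, HasDerivWithinAt Z (Z' τ) (Icc 0 t) τ)
    (hZ' : ∀ τ ∈ Icc 0 t, Z' τ ≤ -κ * Z τ ^ 2 + C) (h0 : Z 0 ≤ -K) :
    ∀ τ ∈ Icc 0 t, Z τ ≤ -K := by
  have hZr : ∀ τ ∈ Ico 0 t, HasDerivWithinAt Z (Z' τ) (Ici τ) τ := fun τ hτ =>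
    (hZ τ (Ico_subset_Icc_self hτ)).mono_of_mem_nhdsWithin (Icc_mem_nhdsGE_of_mem hτ)
  refine fun τ hτ => image_le_of_deriv_right_lt_deriv_boundary (B := fun _ => -K)
    (fun τ hτ => (hZ τ hτ).continuousWithinAt) hZr h0 (fun x => hasDerivAt_const x _)
    (fun τ hτ hτK => ?_) hτ
  have hle := hZ' τ (Ico_subset_Icc_self hτ)
  rw [hτK, neg_sq] at hle
  linarith

lemma mul_lt_neg_inv_of_riccati_le (ht : 0 ≤ t)
    (hZ : ∀ τ ∈ Icc 0 t, HasDerivWithinAt Z (Z' τ) (Icc 0 t) τ)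
    (hZ' : ∀ τ ∈ Icc 0 t, Z' τ ≤ -κ * Z τ ^ 2) (hneg : ∀ τ ∈ Icc 0 t, Z τ < 0) :
    κ * t < -(Z 0)⁻¹ := by
  have hderiv : ∀ τ ∈ Icc 0 t, HasDerivWithinAt (fun τ => (Z τ)⁻¹ - κ * τ)
      (-Z' τ / Z τ ^ 2 - κ * 1) (Icc 0 t) τ := fun τ hτ =>
    ((hZ τ hτ).fun_inv (hneg τ hτ).ne).fun_sub ((hasDerivWithinAt_id τ _).const_mul κ)
  have hmono : MonotoneOn (fun τ => (Z τ)⁻¹ - κ * τ) (Icc 0 t) := by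
    refine monotoneOn_of_hasDerivWithinAt_nonneg (convex_Icc 0 t)
      (fun τ hτ => (hderiv τ hτ).continuousWithinAt)
      (fun τ hτ => (hderiv τ (interior_subset hτ)).mono interior_subset) fun τ hτ => ?_
    have hτ := interior_subset hτ
    rw [mul_one, sub_nonneg, le_div_iff₀ (sq_pos_of_neg (hneg τ hτ))]
    linarith [hZ' τ hτ]
  have hle := hmono (left_mem_Icc.2 ht) (right_mem_Icc.2 ht) ht
  have hlt : (Z t)⁻¹ < 0 := inv_lt_zero.2 (hneg t (right_mem_Icc.2 ht))
  linarith

lemma exists_riccati_threshold {B : ℝ} (hκ : 0 < κ) (hB : 0 < B) (C : ℝ) :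
    ∃ K > 0, ∀ Z Z' : ℝ → ℝ, (∀ τ ∈ Icc 0 B, HasDerivWithinAt Z (Z' τ) (Icc 0 B) τ) →
      (∀ τ ∈ Icc 0 B, Z' τ ≤ -κ * Z τ ^ 2 + C) → -K < Z 0 := by
  obtain ⟨K, hK⟩ : ∃ K, K ≥ max 1 (max (2 * (C + 1) / κ) (2 / (κ * B))) := ⟨_, le_rfl⟩
  obtain ⟨hK1, hKC, hKB⟩ : 1 ≤ K ∧ 2 * (C + 1) / κ ≤ K ∧ 2 / (κ * B) ≤ K := by
    simpa only [ge_iff_le, max_le_iff] using hK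
  have hK0 : 0 < K := one_pos.trans_le hK1
  have hCK : C < κ / 2 * K ^ 2 := by
    rw [div_le_iff₀ hκ] at hKC
    nlinarith [mul_le_mul_of_nonneg_left hK1 (mul_pos hκ hK0).le]
  refine ⟨K, hK0, fun Z Z' hZ hZ' => ?_⟩
  by_contra! h0
  have hle := le_neg_of_riccati_le (hCK.trans_le (by nlinarith)) hZ hZ' h0
  have hZ'' : ∀ τ ∈ Icc 0 B, Z' τ ≤ -(κ / 2) * Z τ ^ 2 := fun τ hτ => by
    have hsq : K ^ 2 ≤ Z τ ^ 2 := by nlinarith [hle τ hτ]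
    linarith [hZ' τ hτ, mul_le_mul_of_nonneg_left hsq (half_pos hκ).le]
  have hlt := mul_lt_neg_inv_of_riccati_le hB.le hZ hZ'' fun τ hτ =>
    (hle τ hτ).trans_lt (neg_lt_zero.2 hK0)
  have hinv : -(Z 0)⁻¹ ≤ K⁻¹ := by
    rw [← inv_neg]
    exact inv_anti₀ hK0 (le_neg.1 h0)
  have hKinv : K⁻¹ ≤ κ / 2 * B := by
    rw [inv_le_comm₀ hK0 (by positivity)]
    exact (by field_simp : (κ / 2 * B)⁻¹ = 2 / (κ * B)).trans_le hKB
  exact (hlt.trans_le (hinv.trans hKinv)).false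

lemma quadratic_le_neg_mul_sq_add {k b a A s S q L : ℝ} (hk : 0 < k) (hb : k ≤ b) (ha : |a| ≤ A)
    (hs : s ≤ S) (hq : |q| ≤ L) (y : ℝ) :
    -b * y ^ 2 - a * y + s ≤
      -(k / 4) * (y + q) ^ 2 + (k / 2 * L ^ 2 + A ^ 2 / (2 * k) + S) := by
  have hsquare : (k * y + a) ^ 2 / (2 * k) = k / 2 * y ^ 2 + a * y + a ^ 2 / (2 * k) := by
    field_simp
    ring
  have hsquare_nonneg : 0 ≤ (k * y + a) ^ 2 / (2 * k) := by positivity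
  have hby : k * y ^ 2 ≤ b * y ^ 2 := mul_le_mul_of_nonneg_right hb (sq_nonneg y)
  have haA : a ^ 2 / (2 * k) ≤ A ^ 2 / (2 * k) :=
    div_le_div_of_nonneg_right (sq_le_sq' (abs_le.1 ha).1 (abs_le.1 ha).2) (by positivity)
  have hqL : q ^ 2 ≤ L ^ 2 := sq_le_sq' (abs_le.1 hq).1 (abs_le.1 hq).2
  have hyq : k / 4 * (y + q) ^ 2 ≤ k / 4 * (2 * (y ^ 2 + L ^ 2)) :=
    mul_le_mul_of_nonneg_left (add_sq_le.trans (by linarith)) (by positivity)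
  linarith

end Riccati

/-- The slope of a Riemann invariant multiplied by the weight, plus a correction which removes the
derivatives of `v` from its evolution equation along characteristics. -/
def weightedSlope (γ lam μ ε : ℝ) (u v : ℝ → ℝ → ℝ) (t x : ℝ) : ℝ :=
  weight γ (u t x) * dx (riemann γ ε u v) t x + damping lam μ t / 2 * weightPrimitive γ (u t x)

section Slope

variable {γ lam μ ε d t t₁ : ℝ} {u₀ v₀ : ℝ → ℝ} {T : ENNReal} {u v : ℝ → ℝ → ℝ}

namespace IsClassicalSolution

variable (h : IsClassicalSolution γ lam μ u₀ v₀ T u v)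
include h

lemma hasDerivWithinAt_dx_riemann (hγ : 1 < γ) (hε : |ε| = 1) (hT : ENNReal.ofReal t₁ < T)
    {X : ℝ → ℝ} (hX : ∀ t ∈ Icc 0 t₁, HasDerivWithinAt X (-ε * sound γ (u t (X t))) (Icc 0 t₁) t)
    (ht : t ∈ Icc 0 t₁) :
    HasDerivWithinAt (fun t => dx (riemann γ ε u v) t (X t))
      (-damping lam μ t * dx v t (X t) - ε * ((γ + 1) / 2) * (sound γ (u t (X t)) / u t (X t)) *
        dx u t (X t) * dx (riemann γ ε u v) t (X t)) (Icc 0 t₁) t := by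
  have hq := mem_strip_of_mem_Icc hT ht (X t)
  have hc : ContDiffOn ℝ 1 (uncurry fun t x => -ε * sound γ (u t x)) (strip T) :=
    h.contDiffOn_comp (contDiffOn_const.mul (contDiffOn_rpow_Ioi _))
  have hb : ContDiffOn ℝ 1 (uncurry fun t x => -damping lam μ t * v t x) (strip T) :=
    (contDiffOn_damping.comp contDiffOn_fst
      fun q hq => neg_one_lt_zero.trans_le hq.1).neg.mul h.v_c1
  refine (hasDerivWithinAt_dx_of_transport (h.contDiffOn_riemann ε) hc hb
    (fun t x hq => h.riemann_transport hγ hε hq) hT hX ht).congr_deriv ?_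
  have hdxb : dx (fun t x => -damping lam μ t * v t x) t (X t) = -damping lam μ t * dx v t (X t) :=
    ((hasDerivAt_dx h.v_c1 hq).const_mul _).deriv
  rw [hdxb, h.dx_comp hq ((hasDerivAt_sound (h.u_pos t _ hq)).const_mul (-ε))]
  ring

lemma hasDerivWithinAt_weightedSlope (hγ : 1 < γ) (hε : |ε| = 1) (hT : ENNReal.ofReal t₁ < T)
    {X : ℝ → ℝ} (hX : ∀ t ∈ Icc 0 t₁, HasDerivWithinAt X (-ε * sound γ (u t (X t))) (Icc 0 t₁) t)
    (ht : t ∈ Icc 0 t₁) :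
    HasDerivWithinAt (fun t => weightedSlope γ lam μ ε u v t (X t))
      (-((γ + 1) / (4 * (u t (X t) * weight γ (u t (X t))))) *
          (weight γ (u t (X t)) * dx (riemann γ ε u v) t (X t)) ^ 2
        - damping lam μ t / 2 * (weight γ (u t (X t)) * dx (riemann γ ε u v) t (X t))
        + -(lam * μ) * (1 + t) ^ (-μ - 1) / 2 * weightPrimitive γ (u t (X t))) (Icc 0 t₁) t := by
  have hin : ∀ t ∈ Icc 0 t₁, (t, X t) ∈ strip T := fun t ht => mem_strip_of_mem_Icc hT ht _
  have hpos := h.u_pos t _ (hin t ht)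
  have hu := hasDerivWithinAt_comp_curve h.u_c1 ht hin (hX t ht)
  have hweight := (hasDerivAt_weight (γ := γ) hpos).comp_hasDerivWithinAt t hu
  have hprimitive := (hasDerivAt_weightPrimitive (γ := γ) hpos).comp_hasDerivWithinAt t hu
  have hdamping := (hasDerivAt_damping (lam := lam) (μ := μ)
    (neg_one_lt_zero.trans_le ht.1)).hasDerivWithinAt (s := Icc 0 t₁)
  refine ((hweight.mul (h.hasDerivWithinAt_dx_riemann hγ hε hT hX ht)).add
    ((hdamping.div_const 2).mul hprimitive)).congr_deriv ?_
  have hmass : dt u t (X t) = dx v t (X t) := sub_eq_zero.1 (h.mass t _ (hin t ht))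
  simp only [Function.comp_apply]
  rw [hmass, h.dx_riemann hγ.ne' (hin t ht)]
  field_simp
  ring

end IsClassicalSolution

lemma exists_weightedSlope_deriv_le (lam μ : ℝ) (hγ : -1 < γ) (hd : 0 < d) (M B : ℝ) :
    ∃ κ > 0, ∃ C, ∀ t ∈ Icc 0 B, ∀ u ∈ Icc d M, ∀ y,
      -((γ + 1) / (4 * (u * weight γ u))) * y ^ 2 - damping lam μ t / 2 * y
        + -(lam * μ) * (1 + t) ^ (-μ - 1) / 2 * weightPrimitive γ u ≤
      -κ * (y + damping lam μ t / 2 * weightPrimitive γ u) ^ 2 + C := by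
  have hsub : Icc d M ⊆ Ioi 0 := fun u hu => hd.trans_le hu.1
  have hcoeff_pos : ∀ u ∈ Icc d M, 0 < (γ + 1) / (4 * (u * weight γ u)) := fun u hu => by
    have hu := hsub hu
    have hw := weight_pos (γ := γ) hu
    exact div_pos (by linarith) (mul_pos four_pos (mul_pos hu hw))
  have hcoeff : ContinuousOn (fun u => (γ + 1) / (4 * (u * weight γ u))) (Icc d M) :=
    continuousOn_const.div
      (continuousOn_const.mul (continuousOn_id.mul (continuousOn_weight.mono hsub)))
      fun u hu hzero => (hcoeff_pos u hu).ne' (by simp only [hzero, div_zero])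
  have hdamping' : ContinuousOn (fun t : ℝ => -(lam * μ) * (1 + t) ^ (-μ - 1) / 2) (Icc 0 B) :=
    (continuousOn_const.mul ((continuousOn_const.add continuousOn_id).rpow_const
      fun t ht => Or.inl (by linarith [ht.1] : 1 + t ≠ 0))).div_const 2
  have hprimitive : ContinuousOn (weightPrimitive γ) (Icc d M) := fun u hu =>
    (hasDerivAt_weightPrimitive (hsub hu)).continuousAt.continuousWithinAt
  obtain ⟨k, hk, hkle⟩ := isCompact_Icc.exists_forall_le' hcoeff hcoeff_pos
  obtain ⟨A, hA⟩ := exists_abs_damping_le lam μ B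
  obtain ⟨A', hA'⟩ := isCompact_Icc.exists_bound_of_continuousOn hdamping'
  obtain ⟨Q, hQ⟩ := isCompact_Icc.exists_bound_of_continuousOn hprimitive
  have hhalf : ∀ t ∈ Icc 0 B, |damping lam μ t / 2| ≤ A / 2 := fun t ht => by
    rw [abs_div, abs_two]
    exact div_le_div_of_nonneg_right (hA t ht) two_pos.le
  have hmul : ∀ {a b α β : ℝ}, |a| ≤ α → |b| ≤ β → |a * b| ≤ α * β := fun ha hb =>
    (abs_mul _ _).trans_le (mul_le_mul ha hb (abs_nonneg _) ((abs_nonneg _).trans ha))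
  exact ⟨k / 4, by positivity, _, fun t ht u hu => quadratic_le_neg_mul_sq_add hk (hkle u hu)
    (hhalf t ht) ((le_abs_self _).trans (hmul (hA' t ht) (hQ u hu))) (hmul (hhalf t ht) (hQ u hu))⟩

lemma exists_weightedSlope_le (lam μ : ℝ) (hd : 0 < d) (M : ℝ) {K : ℝ} (hK : 0 < K) :
    ∃ K' > 0, ∀ u ∈ Icc d M, ∀ y ≤ -K',
      weight γ u * y + damping lam μ 0 / 2 * weightPrimitive γ u ≤ -K := by
  have hsub : Icc d M ⊆ Ioi 0 := fun u hu => hd.trans_le hu.1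
  obtain ⟨l, hl, hlle⟩ := isCompact_Icc.exists_forall_le' (continuousOn_weight.mono hsub)
    fun u hu => weight_pos (γ := γ) (hsub hu)
  have hcorrection : ContinuousOn
      (fun u => damping lam μ 0 / 2 * weightPrimitive γ u) (Icc d M) := fun u hu =>
    ((hasDerivAt_weightPrimitive (hsub hu)).continuousAt.const_mul _).continuousWithinAt
  obtain ⟨L, hL⟩ := isCompact_Icc.exists_bound_of_continuousOn hcorrection
  refine ⟨(K + |L|) / l, by positivity, fun u hu y hy => ?_⟩
  have hy0 : y ≤ 0 := hy.trans (neg_nonpos.2 (by positivity))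
  have hly : l * y ≤ -(K + |L|) := by
    rw [← neg_div, le_div_iff₀ hl] at hy
    linarith
  have hbound := (le_abs_self _).trans ((hL u hu).trans (le_abs_self L))
  linarith [mul_le_mul_of_nonpos_right (hlle u hu) hy0]

end Slope

section BlowUp

variable {γ lam μ d B : ℝ} {u₀ v₀ : ℝ → ℝ} {T : ENNReal} {u v : ℝ → ℝ → ℝ}

lemma exists_le_ofReal_of_dx_riemann_le (lam μ : ℝ) (hγ : 1 < γ) (hd : 0 < d) (M : ℝ) (hB : 0 < B) :
    ∃ K > 0, ∀ (u₀ v₀ : ℝ → ℝ) (T : ENNReal) (u v : ℝ → ℝ → ℝ) (ε x₀ : ℝ),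
      IsSolution γ lam μ u₀ v₀ T u v → (∀ t x, (t, x) ∈ strip T → u t x ∈ Icc d M) →
      |ε| = 1 → dx (riemann γ ε u v) 0 x₀ ≤ -K → T ≤ ENNReal.ofReal B := by
  obtain ⟨κ, hκ, C, hC⟩ := exists_weightedSlope_deriv_le (γ := γ) lam μ (by linarith) hd M B
  obtain ⟨K, hK, hKlt⟩ := exists_riccati_threshold hκ hB C
  obtain ⟨K', hK', hK'le⟩ := exists_weightedSlope_le (γ := γ) lam μ hd M hK
  refine ⟨K', hK', fun u₀ v₀ T u v ε x₀ h hu hε hx₀ => ?_⟩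
  by_contra! hT
  obtain ⟨X, hX0, hX⟩ := h.exists_characteristic (one_pos.trans hγ) hT
    (F := fun u => -ε * sound γ u) (contDiffOn_const.mul (contDiffOn_rpow_Ioi _))
    (left_mem_Icc.2 hB.le) x₀
  have hin : ∀ t ∈ Icc 0 B, u t (X t) ∈ Icc d M := fun t ht =>
    hu t _ (mem_strip_of_mem_Icc hT ht _)
  refine (hKlt (fun t => weightedSlope γ lam μ ε u v t (X t)) _
    (fun t ht => h.classical.hasDerivWithinAt_weightedSlope hγ hε hT hX ht)
    fun t ht => hC t ht _ (hin t ht) _).not_ge ?_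
  exact hK'le _ (hin 0 (left_mem_Icc.2 hB.le)) _ (hX0 ▸ hx₀)

lemma IsClassicalSolution.isSolution (h : IsClassicalSolution γ lam μ u₀ v₀ T u v)
    (hN : NormsBounded γ T u v) : IsSolution γ lam μ u₀ v₀ T u v :=
  ⟨h, fun _ hT' => hN.imp fun _ hC t x hq => hC t x ⟨hq.1, hq.2.trans hT'⟩⟩

lemma exists_abs_deriv_pressure_le (hγ : 0 < γ) (hd : 0 < d) (M : ℝ) :
    ∃ C, ∀ u ∈ Icc d M, |deriv (pressure γ) u| ≤ C := by
  have hsub : Icc d M ⊆ Ioi 0 := fun u hu => hd.trans_le hu.1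
  have hcont : ContinuousOn (fun u => -sound γ u ^ 2) (Icc d M) := fun u hu =>
    ((hasDerivAt_sound (hsub hu)).continuousAt.pow 2).neg.continuousWithinAt
  obtain ⟨C, hC⟩ := isCompact_Icc.exists_bound_of_continuousOn hcont
  exact ⟨C, fun u hu => (hasDerivAt_pressure hγ.ne' (hsub hu)).deriv ▸ hC u hu⟩

lemma IsSolution.derivativeBlowUp (h : IsSolution γ lam μ u₀ v₀ T u v) (hγ : 0 < γ) {m₁ δ₁ : ℝ}
    (hδ₁ : 0 < δ₁) (hX : ∀ t : ℝ, 0 ≤ t → ENNReal.ofReal t < T → InX m₁ δ₁ (u t) (v t))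
    (hN : ¬NormsBounded γ T u v) : DerivativeBlowUp T u v := by
  obtain ⟨P, hP⟩ := exists_abs_deriv_pressure_le hγ hδ₁ m₁
  by_contra hblow
  simp only [DerivativeBlowUp, not_forall, not_exists, not_and, not_lt] at hblow
  obtain ⟨M, T₀, hT₀, hM⟩ := hblow
  obtain ⟨T₁, hT₀₁, hT₁⟩ := exists_between hT₀
  obtain ⟨C, hC⟩ := h.bounded T₁ hT₁
  refine hN ⟨max C (max M (max m₁ P)), fun t x hq => ?_⟩
  rcases lt_or_ge (ENNReal.ofReal t) T₁ with hlt | hge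
  · have hle : C ≤ max C (max M (max m₁ P)) := le_max_left ..
    obtain ⟨h₁, h₂, h₃, h₄, h₅, h₆, h₇⟩ := hC t x ⟨hq.1, hlt⟩
    exact ⟨h₁.trans hle, h₂.trans hle, h₃.trans hle, h₄.trans hle, h₅.trans hle, h₆.trans hle,
      h₇.trans hle⟩
  · have hXt := hX t hq.1 hq.2
    have hslopes := hM t x hq (hT₀₁.le.trans hge)
    have hnorm := hXt.norm_le x x
    have hMle : M ≤ max C (max M (max m₁ P)) := le_max_of_le_right (le_max_left ..)
    have hmle : m₁ ≤ max C (max M (max m₁ P)) :=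
      le_max_of_le_right (le_max_of_le_right (le_max_left ..))
    have hPle : P ≤ max C (max M (max m₁ P)) :=
      le_max_of_le_right (le_max_of_le_right (le_max_right ..))
    have hu := abs_nonneg (u t x)
    have hv := abs_nonneg (v t x)
    have hut := abs_nonneg (dt u t x)
    have hvt := abs_nonneg (dt v t x)
    have hux := abs_nonneg (dx u t x)
    have hvx := abs_nonneg (dx v t x)
    exact ⟨by linarith, by linarith, by linarith, by linarith, by linarith, by linarith,
      (hP _ (hXt.mem_Icc x)).trans hPle⟩

end BlowUp

end DampedPSystem

end

open DampedPSystem in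
theorem theorem2p1_general (γ lam μ : ℝ) (hγ : 1 < γ) (hlam : 0 ≤ lam) (m δ : ℝ) (hm : 0 < m)
    (hδ : 0 < δ) :
    ∃ m₁ > 0, ∃ δ₁ > 0, ∀ B > 0, ∃ K > 0, ∀ (u₀ v₀ : ℝ → ℝ) (x₁ D : ℝ), InX m δ u₀ v₀ →
      D < eta γ (u₀ x₁) / 2 → (∀ x y, |riemannS γ u₀ v₀ x + riemannR γ u₀ v₀ y| ≤ D) →
      (∀ (T : ENNReal) (u v : ℝ → ℝ → ℝ), IsSolution γ lam μ u₀ v₀ T u v →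
        (∀ t : ℝ, 0 ≤ t → ENNReal.ofReal t < T → InX m₁ δ₁ (u t) (v t)) ∧
        (¬NormsBounded γ T u v → DerivativeBlowUp T u v)) ∧
      ((∃ x₀, deriv (riemannR γ u₀ v₀) x₀ ≤ -K ∨ deriv (riemannS γ u₀ v₀) x₀ ≤ -K) →
        lifespan γ lam μ u₀ v₀ ≤ ENNReal.ofReal B) := by
  obtain ⟨m₁, hm₁, δ₁, hδ₁, hbound⟩ := exists_uniform_bounds lam μ hγ hlam hm hδ
  refine ⟨m₁, hm₁, δ₁, hδ₁, fun B hB => ?_⟩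
  obtain ⟨K, hK, hsteep⟩ := exists_le_ofReal_of_dx_riemann_le lam μ hγ hδ₁ m₁ hB
  refine ⟨K, hK, fun u₀ v₀ x₁ D hX hDη hD => ?_⟩
  replace hbound := hbound u₀ v₀ x₁ D hX hDη hD
  refine ⟨fun T u v h => ⟨hbound T u v h,
    h.derivativeBlowUp (one_pos.trans hγ) hδ₁ (hbound T u v h)⟩, ?_⟩
  rintro ⟨x₀, hx₀⟩
  refine sSup_le ?_
  rintro T ⟨-, u, v, hcl, hN⟩
  have h := hcl.isSolution hN
  have hu : ∀ t x, (t, x) ∈ strip T → u t x ∈ Icc δ₁ m₁ := fun t x hq =>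
    (hbound T u v h t hq.1 hq.2).mem_Icc x
  rw [← hcl.riemann_one_zero, ← hcl.riemann_neg_one_zero] at hx₀
  exact hx₀.elim (hsteep u₀ v₀ T u v 1 x₀ h hu abs_one)
    (hsteep u₀ v₀ T u v (-1) x₀ h hu (abs_neg (1 : ℝ) ▸ abs_one))

theorem theorem2p1 (γ lam μ : ℝ) (hγ : 1 < γ)
    (hdamp : (μ = 1 ∧ 0 ≤ lam ∧ lam ≤ 2) ∨ (1 < μ ∧ 0 ≤ lam))
    (m δ : ℝ) (hm : 0 < m) (hδ : 0 < δ) :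
    ∃ m₁ > 0, ∃ δ₁ > 0, ∃ K > 0,
      ∀ (u₀ v₀ : ℝ → ℝ) (uminus vminus : ℝ), DampedPSystem.InX m δ u₀ v₀ →
        0 < uminus →
        Tendsto u₀ atBot (𝓝 uminus) → Tendsto v₀ atBot (𝓝 vminus) →
        -- the supremum of `|s(0,x) + r(0,y)|` is less than `u₋^{-(γ-1)/2} / (γ-1)`
        (∃ D < 1 / (γ - 1) * uminus ^ (-(γ - 1) / 2), ∀ x y,
          |DampedPSystem.riemannS γ u₀ v₀ x + DampedPSystem.riemannR γ u₀ v₀ y| ≤ D) →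
        -- uniform bounds, for as long as the solution exists
        (∀ (T : ENNReal) (u v : ℝ → ℝ → ℝ), DampedPSystem.IsSolution γ lam μ u₀ v₀ T u v →
          ∀ t : ℝ, 0 ≤ t → ENNReal.ofReal t < T → DampedPSystem.InX m₁ δ₁ (u t) (v t)) ∧
        -- blow-up for steep data
        ((∃ x₀ : ℝ, deriv (DampedPSystem.riemannR γ u₀ v₀) x₀ ≤ -K ∨
            deriv (DampedPSystem.riemannS γ u₀ v₀) x₀ ≤ -K) →
          DampedPSystem.lifespan γ lam μ u₀ v₀ < ⊤ ∧
          -- the breakdown of a solution, i.e. of the finiteness of its norms, is a blow-up of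
          -- the first derivatives
          ∀ (T : ENNReal) (u v : ℝ → ℝ → ℝ), DampedPSystem.IsSolution γ lam μ u₀ v₀ T u v →
            ¬ DampedPSystem.NormsBounded γ T u v → DampedPSystem.DerivativeBlowUp T u v) := by
  obtain ⟨m₁, hm₁, δ₁, hδ₁, hgeneral⟩ := theorem2p1_general γ lam μ hγ
    (hdamp.elim (·.2.1) (·.2)) m δ hm hδ
  obtain ⟨K, hK, hdata⟩ := hgeneral 1 one_pos
  refine ⟨m₁, hm₁, δ₁, hδ₁, K, hK, fun u₀ v₀ uminus vminus hX hu hu₀ _ ⟨D, hD, hsum⟩ => ?_⟩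
  obtain ⟨x₁, hx₁⟩ := DampedPSystem.exists_lt_half_eta hu hu₀ hD
  obtain ⟨hsol, hlife⟩ := hdata u₀ v₀ x₁ D hX hx₁ hsum
  exact ⟨fun T u v h => (hsol T u v h).1, fun hsteep =>
    ⟨(hlife hsteep).trans_lt ENNReal.ofReal_lt_top, fun T u v h => (hsol T u v h).2⟩⟩
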